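/- Let $\mathbb{K}$ be a field of characteristic zero, $n\ge 3$, $A_n=\operatorname{Vect}_{\mathbb K}(x_1,\dots,x_n)$, and let $T(A_n)=\bigoplus_{i\ge 0}A_n^{\otimes i}$ be the unital free associative algebra. Let $\operatorname{Der}(T(A_n))$ be the Lie algebra of its derivations, with the commutator bracket, let $\operatorname{Der}(T(A_n))(d)$ be the space of derivations that send elements of degree $m$ to elements of degree $m+d$ for all $m$, and let $\operatorname{Der}_{\ge k}(T(A_n))=\bigoplus_{d\ge k}\operatorname{Der}(T(A_n))(d)$. Let $|T(A_n)|=T(A_n)/[T(A_n),T(A_n)]$ be the space of cyclic words, where $[T(A_n),T(A_n)]$ is the linear span of the commutators, and write $|a|$ for the class of $a$. The Lie algebra $\operatorname{Der}(T(A_n))$ acts on $|T(A_n)|$ by $D\cdot|a|=|D(a)|$ and on $|T(A_n)|\otimes|T(A_n)|$ by $D\cdot(p\otimes q)=(D\cdot p)\otimes q+p\otimes(D\cdot q)$; the latter space is graded by total degree. Let $c:\operatorname{Der}(T(A_n))\to|T(A_n)|\otimes|T(A_n)|$ be a linear map which is a 1-cocycle, i.e. $c([u,v])=u\cdot c(v)-v\cdot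 c(u)$ for all $u,v$, and which is of degree zero, i.e. maps derivations of degree $d$ to elements of degree $d$ for every $d$ (in particular it vanishes on derivations of degree $-1$). Then for every $k\le n$ there are $a,b\in\mathbb{K}$ such that $$c(D)=a\operatorname{Div}(D)+b\,\sigma(\operatorname{Div}(D))\qquad\text{for all } D\in\bigoplus_{d=0}^{k}\operatorname{Der}(T(A_n))(d).$$ In particular, identifying $\operatorname{Der}_{\ge 0}(T(A_n))/\operatorname{Der}_{\ge k}(T(A_n))$ with $\bigoplus_{0\le d<k}\operatorname{Der}(T(A_n))(d)$, the restriction of $c$ to this quotient is a linear combination of $\operatorname{Div}$ and $\sigma\circ\operatorname{Div}$. Here $\sigma(p\otimes q)=q\otimes p$, and $\operatorname{Div}(u)=\sum_{i=1}^n|\partial_i(u(x_i))|$, where $\partial_i:T(A_n)\to T(A_n)\otimes T(A_n)$ is the linear map $x_{i_1}\cdots x_{i_m}\mapsto\sum_{j:\,i_j=i}x_{i_1}\cdots x_{i_{j-1}}\otimes x_{i_{j+1}}\cdots x_{i_m}$ and $|p\otimes q|=|p|\otimes|q|$. -/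

import Mathlib

open scoped TensorProduct

noncomputable section

namespace FreeDer

attribute [local instance] LieRing.ofAssociativeRing

variable (K : Type*) [Field K] (n : ℕ)

/-- The (unital) free associative algebra on `x_0, …, x_{n-1}`, i.e. the tensor algebra of
`A_n = K x_0 ⊕ ⋯ ⊕ K x_{n-1}`. -/
abbrev T : Type _ := FreeAlgebra K (Fin n)

/-- The monomial `x_{i_1} ⋯ x_{i_m}` attached to a word `[i_1, …, i_m]`. -/
def word (w : List (Fin n)) : T K n := (w.map (FreeAlgebra.ι K)).prod

/-- The Lie algebra of derivations of the free associative algebra: the linear endomorphisms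
satisfying the Leibniz rule, with the commutator bracket. -/
def Der : LieSubalgebra K (Module.End K (T K n)) where
  carrier := {D | ∀ a b, D (a * b) = D a * b + a * D b}
  zero_mem' := by intro a b; simp
  add_mem' := by
    intro D E hD hE a b
    have h1 := hD a b
    have h2 := hE a b
    simp only [LinearMap.add_apply, h1, h2, add_mul, mul_add]
    abel
  smul_mem' := by
    intro r D hD a b
    have h1 := hD a b
    simp only [LinearMap.smul_apply, h1, smul_add, smul_mul_assoc, mul_smul_comm]
  lie_mem' := by
    intro D E hD hE a b
    have h1 : ∀ a b, D (a * b) = D a * b + a * D b := hD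
    have h2 : ∀ a b, E (a * b) = E a * b + a * E b := hE
    simp only [LieRing.of_associative_ring_bracket, LinearMap.sub_apply, Module.End.mul_apply,
      h1, h2, map_add, sub_mul, mul_sub]
    abel

/-- The linear span `[T, T]` of the commutators. -/
def commutators : Submodule K (T K n) :=
  Submodule.span K {z | ∃ a b : T K n, z = a * b - b * a}

/-- The space of cyclic words `|T| = T / [T, T]`. -/
abbrev Cyc : Type _ := T K n ⧸ commutators K n

/-- The projection `a ↦ |a|`. -/
abbrev proj : T K n →ₗ[K] Cyc K n := (commutators K n).mkQ

theorem commutators_le_comap (D : Der K n) :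
    commutators K n ≤ (commutators K n).comap (D : Module.End K (T K n)) := by
  refine Submodule.span_le.2 ?_
  rintro z ⟨a, b, rfl⟩
  have hD : ∀ a b, (D : Module.End K (T K n)) (a * b)
      = (D : Module.End K (T K n)) a * b + a * (D : Module.End K (T K n)) b := D.2
  have h1 : (D : Module.End K (T K n)) a * b - b * (D : Module.End K (T K n)) a
      ∈ commutators K n := Submodule.subset_span ⟨_, _, rfl⟩
  have h2 : a * (D : Module.End K (T K n)) b - (D : Module.End K (T K n)) b * a
      ∈ commutators K n := Submodule.subset_span ⟨_, _, rfl⟩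
  have h := (commutators K n).add_mem h1 h2
  change (D : Module.End K (T K n)) (a * b - b * a) ∈ commutators K n
  rw [map_sub, hD, hD]
  convert h using 1
  abel

/-- The map induced on cyclic words by a derivation: `D · |a| = |D a|`. -/
def cycAct (D : Der K n) : Module.End K (Cyc K n) :=
  (commutators K n).mapQ (commutators K n) (D : Module.End K (T K n))
    (commutators_le_comap K n D)

/-- `|T|` is a module over the Lie algebra `Der`; the module structure on `|T| ⊗ |T|` is then
the tensor product one, `D · (p ⊗ q) = (D · p) ⊗ q + p ⊗ (D · q)`. -/
instance instLieRingModuleCyc : LieRingModule (Der K n) (Cyc K n) where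
  bracket D p := cycAct K n D p
  add_lie D E p := by
    obtain ⟨a, rfl⟩ := Submodule.Quotient.mk_surjective _ p
    rfl
  lie_add D p q := map_add (cycAct K n D) p q
  leibniz_lie D E p := by
    obtain ⟨a, rfl⟩ := Submodule.Quotient.mk_surjective _ p
    change proj K n _ = proj K n _ + proj K n _
    rw [← map_add]
    congr 1
    change _ = (⁅(D : Module.End K (T K n)), (E : Module.End K (T K n))⁆ a) + _
    simp [LieRing.of_associative_ring_bracket]

instance instLieModuleCyc : LieModule K (Der K n) (Cyc K n) where
  smul_lie r D p := by
    obtain ⟨a, rfl⟩ := Submodule.Quotient.mk_surjective _ p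
    rfl
  lie_smul r D p := map_smul (cycAct K n D) r p

/-- A linear map `c : L → M` is a 1-cocycle if `c [u, v] = u · c v - v · c u`. -/
def IsOneCocycle {R L M : Type*} [CommRing R] [LieRing L] [LieAlgebra R L]
    [AddCommGroup M] [Module R M] [LieRingModule L M] (c : L →ₗ[R] M) : Prop :=
  ∀ u v : L, c ⁅u, v⁆ = ⁅u, c v⁆ - ⁅v, c u⁆

/-- The homogeneous component of degree `d` of `T` (zero for `d < 0`). -/
def algDeg (d : ℤ) : Submodule K (T K n) :=
  Submodule.span K {a | ∃ w : List (Fin n), (w.length : ℤ) = d ∧ a = word K n w}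

/-- The homogeneous component of degree `d` of `|T| ⊗ |T|` (zero for `d < 0`). -/
def cycTensorDeg (d : ℤ) : Submodule K (Cyc K n ⊗[K] Cyc K n) :=
  Submodule.span K {z | ∃ v w : List (Fin n), ((v.length + w.length : ℕ) : ℤ) = d ∧
    z = proj K n (word K n v) ⊗ₜ[K] proj K n (word K n w)}

/-- The derivations that are homogeneous of degree `d`: they send elements of degree `m` to
elements of degree `m + d`. -/
def derDeg (d : ℤ) : Submodule K (Der K n) where
  carrier := {D | ∀ (m : ℤ), ∀ a ∈ algDeg K n m,
    (D : Module.End K (T K n)) a ∈ algDeg K n (m + d)}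
  zero_mem' := by
    intro m a _
    exact (algDeg K n (m + d)).zero_mem
  add_mem' := by
    intro D E hD hE m a ha
    exact (algDeg K n (m + d)).add_mem (hD m a ha) (hE m a ha)
  smul_mem' := by
    intro r D hD m a ha
    exact (algDeg K n (m + d)).smul_mem r (hD m a ha)

/-- The sum of the homogeneous components of `Der` of degrees `0, 1, …, k`. -/
def derRange (k : ℕ) : Submodule K (Der K n) :=
  ⨆ d ∈ Set.Icc (0 : ℤ) k, derDeg K n d

/-- A linear map `c : Der → |T| ⊗ |T|` is of degree zero if it preserves degrees. -/
def IsDegreeZero (c : Der K n →ₗ[K] Cyc K n ⊗[K] Cyc K n) : Prop :=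
  ∀ d : ℤ, ∀ D ∈ derDeg K n d, c D ∈ cycTensorDeg K n d

/-- The `i`-th noncommutative partial derivative `T → T ⊗ T`: the linear map
`x_{i_1} ⋯ x_{i_m} ↦ ∑_{j : i_j = i} x_{i_1} ⋯ x_{i_{j-1}} ⊗ x_{i_{j+1}} ⋯ x_{i_m}`. -/
def partialD (i : Fin n) : T K n →ₗ[K] T K n ⊗[K] T K n :=
  (FreeAlgebra.basisFreeMonoid K (Fin n)).constr K fun w =>
    ∑ j : Fin w.toList.length, if w.toList[j] = i then
      word K n (w.toList.take j) ⊗ₜ[K] word K n (w.toList.drop (j + 1)) else 0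

/-- The noncommutative divergence `Div u = ∑ i, |∂_i (u x_i)|`. -/
def divergence : Der K n →ₗ[K] Cyc K n ⊗[K] Cyc K n :=
  ∑ i : Fin n, TensorProduct.map (proj K n) (proj K n) ∘ₗ partialD K n i ∘ₗ
    LinearMap.applyₗ (FreeAlgebra.ι K i) ∘ₗ (Der K n).toSubmodule.subtype

/-- The switch `σ (p ⊗ q) = q ⊗ p` of the two factors of `|T| ⊗ |T|`. -/
def switch : Cyc K n ⊗[K] Cyc K n →ₗ[K] Cyc K n ⊗[K] Cyc K n :=
  (TensorProduct.comm K (Cyc K n) (Cyc K n)).toLinearMap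

end FreeDer

end

/-!
Write `t ∂_i` for the derivation with `x_i ↦ t` that kills the other generators.

A cocycle `c` of degree zero sends linear vector fields to multiples of `1 ⊗ 1`, which every
derivation kills, so `c` is equivariant under linear vector fields (`map_lie_linear`). In particular
it preserves the weights of the Euler fields `x_i ∂_i`. As these weights are nonnegative on
`|T| ⊗ |T|`, `c (w ∂_i) = 0` if `x_i` does not occur in `w`.

Next, mark a letter `z`. The weights determine `c (x_a x_z x_b ∂_z)` up to four coefficients, and
bracketing with derivations that do not involve `x_z` gives, for all `u, v` without `x_z`,
`c (u x_z v ∂_z) = α |uv| ⊗ 1 + β 1 ⊗ |uv| + γ |u| ⊗ |v| + δ |v| ⊗ |u|`. The bracket of two such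
derivations is killed by `c` and equals `(u' u x_z v v' - u u' x_z v' v) ∂_z`; since the cyclic words
`|u' u v v'|` and `|u u' v' v|` may differ, `α = β = 0` (`exists_map_single_eq`). A linear vector field
shows that `γ` and `δ` do not depend on `z` (`exists_map_single_eq_uniform`).

So `g = c - γ Div - δ σ Div`, a cocycle because `Div` is one (`isOneCocycle_divergence`), vanishes on
all `w ∂_z` with at most one letter `x_z` in `w`. The kernel of a cocycle is closed under brackets,
and for `n ≥ 3` brackets of such derivations span all degrees up to `n` (`mono_mem`). If `w` contains
`z` several times and misses a letter, a linear vector field lowers the multiplicity of `z`; if it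
misses none, its length `≤ n + 1` forces `z` to occur twice and the others once, and a few explicit
brackets deal with this case.
-/

noncomputable section

namespace FreeDer

attribute [local instance] LieRing.ofAssociativeRing

variable {K : Type*} [Field K] {n : ℕ}

/-! ### Words and derivations of the free associative algebra -/

@[simp] theorem word_nil : word K n [] = 1 := rfl

@[simp] theorem word_cons (i : Fin n) (w : List (Fin n)) :
    word K n (i :: w) = FreeAlgebra.ι K i * word K n w := by simp [word]

@[simp] theorem word_append (v w : List (Fin n)) :
    word K n (v ++ w) = word K n v * word K n w := by simp [word]

theorem basisFreeMonoid_eq_word (w : FreeMonoid (Fin n)) :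
    FreeAlgebra.basisFreeMonoid K (Fin n) w = word K n w.toList := by
  simp only [FreeAlgebra.basisFreeMonoid, Module.Basis.map_apply]
  change FreeAlgebra.equivMonoidAlgebraFreeMonoid.symm (MonoidAlgebra.single w 1) = _
  simp [FreeAlgebra.equivMonoidAlgebraFreeMonoid, FreeMonoid.lift_apply, word]

theorem span_range_word : Submodule.span K (Set.range (word K n)) = ⊤ := by
  rw [← (FreeAlgebra.basisFreeMonoid K (Fin n)).span_eq]
  congr 1
  ext x
  constructor
  · rintro ⟨w, rfl⟩
    exact ⟨FreeMonoid.ofList w, by rw [basisFreeMonoid_eq_word]; rfl⟩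
  · rintro ⟨w, rfl⟩
    exact ⟨w.toList, (basisFreeMonoid_eq_word w).symm⟩

theorem linearMap_ext_word {M : Type*} [AddCommMonoid M] [Module K M] {f g : T K n →ₗ[K] M}
    (h : ∀ w, f (word K n w) = g (word K n w)) : f = g :=
  (FreeAlgebra.basisFreeMonoid K (Fin n)).ext fun w => by
    rw [basisFreeMonoid_eq_word]; exact h _

theorem Der.map_mul (D : Der K n) (a b : T K n) : D.1 (a * b) = D.1 a * b + a * D.1 b :=
  D.2 a b

@[simp] theorem Der.map_one (D : Der K n) : D.1 1 = 0 := by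
  have h := Der.map_mul D 1 1
  simpa using h

@[simp] theorem Der.map_algebraMap (D : Der K n) (r : K) : D.1 (algebraMap K (T K n) r) = 0 := by
  rw [Algebra.algebraMap_eq_smul_one, map_smul, Der.map_one, smul_zero]

/-- Two derivations agree as soon as they agree on the generators. -/
theorem Der.ext_ι {D E : Der K n}
    (h : ∀ i, D.1 (FreeAlgebra.ι K i) = E.1 (FreeAlgebra.ι K i)) : D = E := by
  refine Subtype.ext (LinearMap.ext fun a => ?_)
  induction a using FreeAlgebra.induction with
  | grade0 r => rw [Der.map_algebraMap, Der.map_algebraMap]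
  | grade1 i => exact h i
  | mul a b ha hb => rw [Der.map_mul, Der.map_mul, ha, hb]
  | add a b ha hb => rw [map_add, map_add, ha, hb]

theorem Der.lie_apply (D E : Der K n) (a : T K n) :
    (⁅D, E⁆ : Der K n).1 a = D.1 (E.1 a) - E.1 (D.1 a) := rfl

/-- The algebra map `a ↦ a + ε D a` into the dual numbers over `T`, where `D` is the derivation
with prescribed values on the generators. -/
def toDualNumbers (f : Fin n → T K n) : T K n →ₐ[K] TrivSqZeroExt (T K n) (T K n) :=
  FreeAlgebra.lift K fun i => TrivSqZeroExt.inl (FreeAlgebra.ι K i) + TrivSqZeroExt.inr (f i)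

theorem fst_toDualNumbers (f : Fin n → T K n) (a : T K n) : (toDualNumbers f a).fst = a := by
  have h : (TrivSqZeroExt.fstHom K (T K n) (T K n)).comp (toDualNumbers f) = AlgHom.id K _ := by
    ext i
    simp [toDualNumbers]
  exact DFunLike.congr_fun h a

/-- The derivation with prescribed values on the generators. -/
def ofImages (f : Fin n → T K n) : Der K n :=
  ⟨(TrivSqZeroExt.sndHom (T K n) (T K n)).restrictScalars K ∘ₗ (toDualNumbers f).toLinearMap, by
    intro a b
    simp [fst_toDualNumbers, add_comm]⟩

@[simp] theorem ofImages_ι (f : Fin n → T K n) (i : Fin n) :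
    (ofImages f).1 (FreeAlgebra.ι K i) = f i := by
  simp [ofImages, toDualNumbers]

/-- The derivation `t ∂_i`, which sends `x_i` to `t` and the other generators to zero. -/
def single (i : Fin n) : T K n →ₗ[K] Der K n where
  toFun t := ofImages (Pi.single i t)
  map_add' s t := Der.ext_ι fun j => by
    simp [Pi.single_add]
  map_smul' r t := Der.ext_ι fun j => by
    simp [Pi.single_smul]

theorem single_ι (i j : Fin n) (t : T K n) :
    (single i t).1 (FreeAlgebra.ι K j) = if j = i then t else 0 := by
  simp [single, Pi.single_apply]

@[simp] theorem single_ι_self (i : Fin n) (t : T K n) :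
    (single i t).1 (FreeAlgebra.ι K i) = t := by simp [single_ι]

theorem single_ι_of_ne {i j : Fin n} (h : j ≠ i) (t : T K n) :
    (single i t).1 (FreeAlgebra.ι K j) = 0 := by simp [single_ι, h]

theorem Der.eq_sum_single (D : Der K n) : D = ∑ i, single i (D.1 (FreeAlgebra.ι K i)) :=
  Der.ext_ι fun j => by
    have : (∑ i, single i (D.1 (FreeAlgebra.ι K i))).1 =
        ∑ i, (single i (D.1 (FreeAlgebra.ι K i))).1 :=
      map_sum (Der K n).toSubmodule.subtype _ _
    rw [this]
    simp [LinearMap.sum_apply, single_ι]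

theorem lie_single_single (i j : Fin n) (s t : T K n) :
    ⁅single i s, single j t⁆ = single j ((single i s).1 t) - single i ((single j t).1 s) :=
  Der.ext_ι fun k => by
    have h : (single j ((single i s).1 t) - single i ((single j t).1 s)).1 =
      (single j ((single i s).1 t)).1 - (single i ((single j t).1 s)).1 := rfl
    rw [Der.lie_apply, h, LinearMap.sub_apply]
    simp only [single_ι]
    split_ifs <;> simp

/-- The subalgebra of polynomials in the letters other than `z`. -/
def avoid (z : Fin n) : Subalgebra K (T K n) :=
  Algebra.adjoin K {a | ∃ i, i ≠ z ∧ a = FreeAlgebra.ι K i}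

theorem ι_mem_avoid {i z : Fin n} (h : i ≠ z) : FreeAlgebra.ι K i ∈ avoid (K := K) z :=
  Algebra.subset_adjoin ⟨i, h, rfl⟩

theorem word_mem_avoid {z : Fin n} {w : List (Fin n)} (h : z ∉ w) :
    word K n w ∈ avoid (K := K) z := by
  induction w with
  | nil => exact (avoid z).one_mem
  | cons i w ih =>
    rw [List.mem_cons, not_or] at h
    rw [word_cons]
    exact (avoid z).mul_mem (ι_mem_avoid (Ne.symm h.1)) (ih h.2)

theorem Der.map_mem_avoid {z : Fin n} {D : Der K n}
    (hD : ∀ i, i ≠ z → D.1 (FreeAlgebra.ι K i) ∈ avoid (K := K) z) {a : T K n}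
    (ha : a ∈ avoid (K := K) z) : D.1 a ∈ avoid (K := K) z := by
  induction ha using Algebra.adjoin_induction with
  | mem x hx => obtain ⟨i, hi, rfl⟩ := hx; exact hD i hi
  | algebraMap r => rw [Der.map_algebraMap]; exact (avoid z).zero_mem
  | add x y _ _ hx hy => rw [map_add]; exact (avoid z).add_mem hx hy
  | mul x y hx' hy' hx hy =>
    rw [Der.map_mul]
    exact (avoid z).add_mem ((avoid z).mul_mem hx hy') ((avoid z).mul_mem hx' hy)

theorem single_map_mem_avoid {z : Fin n} (i : Fin n) {s a : T K n}
    (hs : s ∈ avoid (K := K) z) (ha : a ∈ avoid (K := K) z) :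
    (single i s).1 a ∈ avoid (K := K) z :=
  Der.map_mem_avoid (fun j _ => by
    rw [single_ι]; split_ifs; exacts [hs, (avoid z).zero_mem]) ha

theorem single_of_mem_avoid {z : Fin n} (t : T K n) {a : T K n}
    (ha : a ∈ avoid (K := K) z) : (single z t).1 a = 0 := by
  induction ha using Algebra.adjoin_induction with
  | mem x hx => obtain ⟨i, hi, rfl⟩ := hx; exact single_ι_of_ne hi t
  | algebraMap r => rw [Der.map_algebraMap]
  | add x y _ _ hx hy => rw [map_add, hx, hy, add_zero]
  | mul x y hx' hy' hx hy => rw [Der.map_mul, hx, hy, zero_mul, mul_zero, add_zero]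

theorem single_word_of_notMem {z : Fin n} (t : T K n) {w : List (Fin n)} (h : z ∉ w) :
    (single z t).1 (word K n w) = 0 :=
  single_of_mem_avoid t (word_mem_avoid h)

/-- The derivation `x_i ∂_i` multiplies a word by its number of letters `i`. -/
theorem euler_word (i : Fin n) (w : List (Fin n)) :
    (single i (FreeAlgebra.ι K i)).1 (word K n w) = (w.count i : K) • word K n w := by
  induction w with
  | nil => simp
  | cons j w ih =>
    rw [word_cons, Der.map_mul, ih, single_ι]
    by_cases h : j = i
    · subst h; simp [add_smul, add_comm]
    · simp [h]

theorem lie_euler_single_word (i j : Fin n) (w : List (Fin n)) :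
    ⁅single i (FreeAlgebra.ι K i), single j (word K n w)⁆ =
      ((w.count i : K) - if i = j then 1 else 0) • single j (word K n w) := by
  rw [lie_single_single, euler_word, single_ι, map_smul, sub_smul]
  split_ifs with h
  · rw [h, one_smul]
  · simp

/-! ### Cyclic words -/

theorem proj_mul_comm (a b : T K n) : proj K n (a * b) = proj K n (b * a) := by
  rw [← sub_eq_zero, ← map_sub]
  exact (Submodule.Quotient.mk_eq_zero _).2 (Submodule.subset_span ⟨a, b, rfl⟩)

@[simp] theorem lie_proj (D : Der K n) (a : T K n) :
    ⁅D, proj K n a⁆ = proj K n (D.1 a) := rfl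

open Classical in
/-- The coefficient of the cyclic word `|w₀|`, as a functional on cyclic words. -/
def cycCoeff (w₀ : List (Fin n)) : Cyc K n →ₗ[K] K :=
  (commutators K n).liftQ ((FreeAlgebra.basisFreeMonoid K (Fin n)).constr K fun w =>
    if w.toList ~r w₀ then 1 else 0) <| by
  set φ := (FreeAlgebra.basisFreeMonoid K (Fin n)).constr K
    (fun w => if w.toList ~r w₀ then (1 : K) else 0) with hφ
  have hw (w : List (Fin n)) : φ (word K n w) = if w ~r w₀ then 1 else 0 := by
    have := (FreeAlgebra.basisFreeMonoid K (Fin n)).constr_basis K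
      (fun w => if w.toList ~r w₀ then (1 : K) else 0) (FreeMonoid.ofList w)
    rwa [basisFreeMonoid_eq_word] at this
  have h : (LinearMap.mul K (T K n)).compr₂ φ = (LinearMap.mul K (T K n)).flip.compr₂ φ := by
    refine linearMap_ext_word fun v => linearMap_ext_word fun w => ?_
    have hvw : v ++ w ~r w₀ ↔ w ++ v ~r w₀ :=
      ⟨List.isRotated_append.trans, List.isRotated_append.trans⟩
    simp only [LinearMap.compr₂_apply, LinearMap.flip_apply, LinearMap.mul_apply', ← word_append,
      hw, hvw]
  refine Submodule.span_le.2 ?_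
  rintro _ ⟨a, b, rfl⟩
  have := LinearMap.congr_fun (LinearMap.congr_fun h a) b
  simpa [sub_eq_zero] using this

open Classical in
theorem cycCoeff_word (w₀ w : List (Fin n)) :
    cycCoeff w₀ (proj K n (word K n w)) = if w ~r w₀ then 1 else 0 := by
  have := (FreeAlgebra.basisFreeMonoid K (Fin n)).constr_basis K
    (fun w => if w.toList ~r w₀ then (1 : K) else 0) (FreeMonoid.ofList w)
  rwa [basisFreeMonoid_eq_word] at this

/-- The pairing of `|T| ⊗ |T|` with a pair of cyclic words. -/
def cycCoeff₂ (v₀ w₀ : List (Fin n)) : Cyc K n ⊗[K] Cyc K n →ₗ[K] K :=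
  LinearMap.mul' K K ∘ₗ TensorProduct.map (cycCoeff v₀) (cycCoeff w₀)

@[simp] theorem cycCoeff₂_tmul (v₀ w₀ : List (Fin n)) (p q : Cyc K n) :
    cycCoeff₂ v₀ w₀ (p ⊗ₜ[K] q) = cycCoeff v₀ p * cycCoeff w₀ q := by
  simp [cycCoeff₂]

/-- The element `|v| ⊗ |w|` attached to a pair of words. -/
def wordPair (p : List (Fin n) × List (Fin n)) : Cyc K n ⊗[K] Cyc K n :=
  proj K n (word K n p.1) ⊗ₜ[K] proj K n (word K n p.2)

theorem span_wordPair : Submodule.span K (Set.range (wordPair (K := K) (n := n))) = ⊤ := by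
  have h : Submodule.span K (Set.range fun w => proj K n (word K n w)) = ⊤ := by
    rw [Set.range_comp' (proj K n), ← Submodule.map_span, span_range_word, Submodule.map_top,
      Submodule.range_mkQ]
  have h2 := Submodule.map₂_span_span K (TensorProduct.mk K (Cyc K n) (Cyc K n))
    (Set.range fun w => proj K n (word K n w)) (Set.range fun w => proj K n (word K n w))
  rw [h, TensorProduct.map₂_mk_top_top_eq_top] at h2
  rw [h2]
  congr 1
  ext x
  simp [wordPair, Set.mem_image2]

/-! ### Weights -/

/-- An eigenvector in the span of a family of eigenvectors lies in the span of those members of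
the family that have the same eigenvalue. -/
theorem mem_span_image_of_eigenvector {M ι : Type*} [AddCommGroup M] [Module K M]
    (e : Module.End K M) (b : ι → M) (μ : ι → K) (he : ∀ j, e (b j) = μ j • b j)
    (s : Set ι) {ν : K} {x : M} (hx : x ∈ Submodule.span K (b '' s)) (hex : e x = ν • x) :
    x ∈ Submodule.span K (b '' {j ∈ s | μ j = ν}) := by
  set V : Submodule K M := Submodule.span K (b '' {j ∈ s | μ j = ν})
  set W : Submodule K M := Submodule.span K (b '' {j ∈ s | μ j ≠ ν})
  have hW : W ≤ ⨆ (κ : K) (_ : κ ≠ ν), e.eigenspace κ := by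
    refine Submodule.span_le.2 ?_
    rintro _ ⟨j, ⟨_, hj⟩, rfl⟩
    exact Submodule.mem_iSup_of_mem (μ j) (Submodule.mem_iSup_of_mem hj
      (Module.End.mem_eigenspace_iff.2 (he j)))
  have hV : V ≤ e.eigenspace ν := by
    refine Submodule.span_le.2 ?_
    rintro _ ⟨j, ⟨_, hj⟩, rfl⟩
    exact Module.End.mem_eigenspace_iff.2 (by rw [he, hj])
  have hVW : x ∈ V ⊔ W := by
    rw [← Submodule.span_union, ← Set.image_union]
    convert hx using 3
    ext j
    by_cases h : μ j = ν <;> simp [h]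
  obtain ⟨v, hv, w, hw, rfl⟩ := Submodule.mem_sup.1 hVW
  have hw' : w ∈ e.eigenspace ν := by
    have h1 := (e.eigenspace ν).sub_mem (Module.End.mem_eigenspace_iff.2 hex) (hV hv)
    simpa using h1
  have h0 : w = 0 := Submodule.disjoint_def.1 (e.eigenspaces_iSupIndep ν) w hw' (hW hw)
  rw [h0, add_zero]
  exact hv

theorem lie_euler_wordPair (i : Fin n) (p : List (Fin n) × List (Fin n)) :
    ⁅single i (FreeAlgebra.ι K i), wordPair (K := K) p⁆ =
      ((p.1 ++ p.2).count i : K) • wordPair p := by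
  rw [wordPair, TensorProduct.LieModule.lie_tmul_right, lie_proj, lie_proj, euler_word, euler_word,
    map_smul, map_smul, List.count_append, Nat.cast_add, add_smul, TensorProduct.smul_tmul',
    TensorProduct.tmul_smul]

/-- A vector of weight `ν` for `x_i ∂_i` involves only pairs of words in which `x_i` occurs `ν`
times. -/
theorem mem_span_of_lie_euler (i : Fin n) (s : Set (List (Fin n) × List (Fin n))) {ν : K}
    {x : Cyc K n ⊗[K] Cyc K n} (hx : x ∈ Submodule.span K (wordPair '' s))
    (h : ⁅single i (FreeAlgebra.ι K i), x⁆ = ν • x) :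
    x ∈ Submodule.span K (wordPair '' {p ∈ s | ((p.1 ++ p.2).count i : K) = ν}) :=
  mem_span_image_of_eigenvector
    (LieModule.toEnd K (Der K n) (Cyc K n ⊗[K] Cyc K n) (single i (FreeAlgebra.ι K i)))
    wordPair _ (lie_euler_wordPair i) s hx h

/-- A vector of weight zero for `x_z ∂_z` is killed by every derivation `t ∂_z`. -/
theorem lie_single_eq_zero [CharZero K] (z : Fin n) (t : T K n) {x : Cyc K n ⊗[K] Cyc K n}
    (h : ⁅single z (FreeAlgebra.ι K z), x⁆ = 0) : ⁅single z t, x⁆ = 0 := by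
  have hx := mem_span_of_lie_euler z Set.univ (ν := 0) (x := x)
    (by rw [Set.image_univ, span_wordPair]; trivial) (by rw [h, zero_smul])
  refine Submodule.span_induction ?_ (lie_zero _) ?_ ?_ hx
  · rintro _ ⟨⟨v, w⟩, ⟨_, hp⟩, rfl⟩
    rw [Nat.cast_eq_zero, List.count_append, Nat.add_eq_zero_iff, List.count_eq_zero,
      List.count_eq_zero] at hp
    rw [wordPair, TensorProduct.LieModule.lie_tmul_right, lie_proj, lie_proj,
      single_word_of_notMem t hp.1, single_word_of_notMem t hp.2]
    simp
  · intro x y _ _ hx hy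
    rw [lie_add, hx, hy, add_zero]
  · intro r x _ hx
    rw [lie_smul, hx, smul_zero]

/-! ### Consequences of the equivariance under linear vector fields -/

theorem single_ι_mem_derDeg (i j : Fin n) :
    single i (FreeAlgebra.ι K j) ∈ derDeg K n 0 := by
  intro m a ha
  rw [add_zero]
  refine Submodule.span_induction ?_ (by rw [map_zero]; exact Submodule.zero_mem _)
    (fun x y _ _ hx hy => by rw [map_add]; exact Submodule.add_mem _ hx hy)
    (fun r x _ hx => by rw [map_smul]; exact Submodule.smul_mem _ r hx) ha
  rintro _ ⟨w, rfl, rfl⟩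
  clear ha
  induction w with
  | nil => simp
  | cons k w ih =>
    have hk (l : Fin n) {b : T K n} (hb : b ∈ algDeg K n w.length) :
        FreeAlgebra.ι K l * b ∈ algDeg K n (k :: w).length := by
      refine Submodule.span_induction ?_ (by simp)
        (fun x y _ _ hx hy => by rw [mul_add]; exact Submodule.add_mem _ hx hy)
        (fun r x _ hx => by rw [mul_smul_comm]; exact Submodule.smul_mem _ r hx) hb
      rintro _ ⟨v, hv, rfl⟩
      exact Submodule.subset_span ⟨l :: v, by simp_all, by simp⟩
    rw [word_cons, Der.map_mul, single_ι]
    refine Submodule.add_mem _ ?_ (hk k ih)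
    split_ifs
    · exact hk j (Submodule.subset_span ⟨w, rfl, rfl⟩)
    · simp

section Cocycle

variable {c : Der K n →ₗ[K] Cyc K n ⊗[K] Cyc K n}

/-- A cocycle of degree zero maps linear vector fields to multiples of `1 ⊗ 1`, on which all
derivations act by zero; so it is equivariant under linear vector fields. -/
theorem map_lie_linear (hc : IsOneCocycle c) (hdeg : IsDegreeZero K n c) (i j : Fin n)
    (D : Der K n) :
    c ⁅single i (FreeAlgebra.ι K j), D⁆ = ⁅single i (FreeAlgebra.ι K j), c D⁆ := by
  have h : ⁅D, c (single i (FreeAlgebra.ι K j))⁆ = 0 := by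
    refine Submodule.span_induction ?_ (lie_zero _)
      (fun x y _ _ hx hy => by rw [lie_add, hx, hy, add_zero])
      (fun r x _ hx => by rw [lie_smul, hx, smul_zero]) (hdeg 0 _ (single_ι_mem_derDeg i j))
    rintro _ ⟨v, w, h, rfl⟩
    have h' : v.length + w.length = 0 := by exact_mod_cast h
    rw [Nat.add_eq_zero_iff, List.length_eq_zero_iff, List.length_eq_zero_iff] at h'
    rw [h'.1, h'.2, TensorProduct.LieModule.lie_tmul_right, lie_proj]
    simp
  rw [hc, h, sub_zero]

/-- If `x_i` does not occur in `w`, the derivation `w ∂_i` has weight `-1` for `x_i ∂_i`, and this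
is not a weight of `|T| ⊗ |T|`. -/
theorem map_single_eq_zero [CharZero K] (hc : IsOneCocycle c) (hdeg : IsDegreeZero K n c)
    {i : Fin n} {w : List (Fin n)} (hw : i ∉ w) : c (single i (word K n w)) = 0 := by
  have h := map_lie_linear hc hdeg i i (single i (word K n w))
  rw [lie_euler_single_word, map_smul, List.count_eq_zero.2 hw, if_pos rfl] at h
  have hx := mem_span_of_lie_euler i Set.univ (by rw [Set.image_univ, span_wordPair]; trivial)
    h.symm
  have h0 : {p ∈ (Set.univ : Set (List (Fin n) × List (Fin n))) |
      ((p.1 ++ p.2).count i : K) = ((0 : ℕ) : K) - 1} = ∅ := by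
    ext p
    simp only [Set.mem_univ, true_and, Set.mem_ofPred_eq, Set.mem_empty_iff_false, iff_false]
    intro h
    have h1 : (((p.1 ++ p.2).count i + 1 : ℕ) : K) = 0 := by
      rw [Nat.cast_add, h]; simp
    exact Nat.succ_ne_zero _ (Nat.cast_eq_zero.1 h1)
  rw [h0, Set.image_empty, Submodule.span_empty, Submodule.mem_bot] at hx
  exact hx

/-- The value of `c` at a derivation `y ∂_a` that does not involve `x_z` does not involve `x_z`
either, so it is killed by `t ∂_z`; hence `c` is equivariant under `y ∂_a` on the `t ∂_z`. -/
theorem map_lie_of_mem_avoid [CharZero K] (hc : IsOneCocycle c) (hdeg : IsDegreeZero K n c)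
    {a z : Fin n} (haz : a ≠ z) {y : T K n} (hy : y ∈ avoid (K := K) z) (t : T K n) :
    c (single z ((single a y).1 t)) = ⁅single a y, c (single z t)⁆ := by
  have h0 : ⁅single z t, c (single a y)⁆ = 0 := by
    refine lie_single_eq_zero z t ?_
    rw [← map_lie_linear hc hdeg, lie_single_single, single_of_mem_avoid _ hy,
      single_ι_of_ne haz.symm]
    simp
  have h := hc (single a y) (single z t)
  rw [h0, sub_zero, lie_single_single, single_of_mem_avoid t hy] at h
  simpa using h

end Cocycle

/-! ### Derivations with exactly one marked letter -/

/-- The bilinear expression `α |uv| ⊗ 1 + β 1 ⊗ |uv| + γ |u| ⊗ |v| + δ |v| ⊗ |u|`. -/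
def pairing (α β γ δ : K) (u v : T K n) : Cyc K n ⊗[K] Cyc K n :=
  α • proj K n (u * v) ⊗ₜ[K] proj K n 1 + β • proj K n 1 ⊗ₜ[K] proj K n (u * v) +
    γ • proj K n u ⊗ₜ[K] proj K n v + δ • proj K n v ⊗ₜ[K] proj K n u

theorem lie_pairing (α β γ δ : K) (D : Der K n) (u v : T K n) :
    ⁅D, pairing α β γ δ u v⁆ =
      pairing α β γ δ (D.1 u) v + pairing α β γ δ u (D.1 v) := by
  have h (r : K) (x : Cyc K n ⊗[K] Cyc K n) : ⁅D, r • x⁆ = r • ⁅D, x⁆ := lie_smul r D x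
  simp only [pairing, lie_add, h, TensorProduct.LieModule.lie_tmul_right, lie_proj,
    Der.map_one, Der.map_mul, map_add, map_zero, TensorProduct.add_tmul, TensorProduct.tmul_add,
    TensorProduct.zero_tmul, TensorProduct.tmul_zero, smul_add]
  abel

@[simp] theorem pairing_zero_left (α β γ δ : K) (v : T K n) : pairing α β γ δ 0 v = 0 := by
  simp [pairing]

@[simp] theorem pairing_zero_right (α β γ δ : K) (u : T K n) : pairing α β γ δ u 0 = 0 := by
  simp [pairing]

section Cocycle

variable [CharZero K] {c : Der K n →ₗ[K] Cyc K n ⊗[K] Cyc K n}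

/-- The weight of `x_a x_z x_b ∂_z` determines its value up to four coefficients. -/
theorem exists_map_eq_pairing (hc : IsOneCocycle c) (hdeg : IsDegreeZero K n c)
    {a b z : Fin n} (ha : a ≠ z) (hb : b ≠ z) :
    ∃ α β γ δ : K, c (single z (word K n [a, z, b])) =
      pairing α β γ δ (word K n [a]) (word K n [b]) := by
  set x := c (single z (word K n [a, z, b])) with hx
  have hi (i : Fin n) : ⁅single i (FreeAlgebra.ι K i), x⁆ = ([a, b].count i : K) • x := by
    rw [← map_lie_linear hc hdeg, lie_euler_single_word, map_smul]
    congr 1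
    by_cases h : i = z
    · subst h; simp [ha, hb]
    · simp [h, Ne.symm h, List.count_cons]
  have hs (s : Finset (Fin n)) : x ∈ Submodule.span K (wordPair ''
      {p | ∀ i ∈ s, (p.1 ++ p.2).count i = [a, b].count i}) := by
    induction s using Finset.induction_on with
    | empty => simp [span_wordPair]
    | insert i s _ ih =>
      refine Submodule.span_mono (Set.image_mono ?_) (mem_span_of_lie_euler i _ ih (hi i))
      rintro p ⟨hp, hpi⟩ j hj
      rcases Finset.mem_insert.1 hj with rfl | hj
      · exact Nat.cast_injective hpi
      · exact hp j hj
  have hx' := hs Finset.univ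
  clear_value x
  refine Submodule.span_induction ?_ ⟨0, 0, 0, 0, by simp [pairing]⟩ ?_ ?_ hx'
  · rintro _ ⟨⟨v, w⟩, hp, rfl⟩
    have hperm : v ++ w ∈ [a, b].permutations :=
      List.mem_permutations.2 (List.perm_iff_count.2 fun i => hp i (Finset.mem_univ i))
    have hvw : v ++ w = [a, b] ∨ v ++ w = [b, a] := by
      simpa [List.permutations, List.permutationsAux, List.permutationsAux.rec] using hperm
    rcases v with _ | ⟨p, _ | ⟨q, v⟩⟩
    · rcases hvw with h | h
      · exact ⟨0, 1, 0, 0, by simp_all [pairing, wordPair]⟩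
      · refine ⟨0, 1, 0, 0, ?_⟩
        rw [List.nil_append] at h
        rw [h, pairing, ← word_append]
        simp only [zero_smul, one_smul, zero_add, add_zero, wordPair]
        rw [List.cons_append, List.nil_append, word_nil,
          show [b, a] = [b] ++ [a] from rfl, word_append, proj_mul_comm, ← word_append]
        rfl
    · rcases hvw with h | h
      · exact ⟨0, 0, 1, 0, by simp_all [pairing, wordPair]⟩
      · exact ⟨0, 0, 0, 1, by simp_all [pairing, wordPair]⟩
    · rcases hvw with h | h
      · exact ⟨1, 0, 0, 0, by simp_all [pairing, wordPair]⟩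
      · refine ⟨1, 0, 0, 0, ?_⟩
        have hv : p :: q :: v = [b, a] ∧ w = [] := by simp_all
        rw [hv.1, hv.2, pairing, ← word_append]
        simp only [zero_smul, one_smul, add_zero, wordPair]
        rw [List.cons_append, List.nil_append, word_nil,
          show [b, a] = [b] ++ [a] from rfl, word_append, proj_mul_comm, ← word_append]
        rfl
  · rintro _ _ _ _ ⟨α, β, γ, δ, rfl⟩ ⟨α', β', γ', δ', rfl⟩
    refine ⟨α + α', β + β', γ + γ', δ + δ', ?_⟩
    simp only [pairing, add_smul]
    abel
  · rintro r _ _ ⟨α, β, γ, δ, rfl⟩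
    exact ⟨r * α, r * β, r * γ, r * δ, by simp only [pairing, smul_add, mul_smul]⟩

/-- Bracketing with `u ∂_a` and then with `v ∂_b`, where `u` and `v` do not involve `x_z`, propagates
the value at `x_a x_z x_b ∂_z` to all `u x_z v ∂_z`. -/
theorem map_single_eq_pairing (hc : IsOneCocycle c) (hdeg : IsDegreeZero K n c)
    {a b z : Fin n} (hab : a ≠ b) (ha : a ≠ z) (hb : b ≠ z) {α β γ δ : K}
    (h : c (single z (word K n [a, z, b])) = pairing α β γ δ (word K n [a]) (word K n [b]))
    {u v : T K n} (hu : u ∈ avoid (K := K) z) (hv : v ∈ avoid (K := K) z) :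
    c (single z (u * FreeAlgebra.ι K z * v)) = pairing α β γ δ u v := by
  have h1 {u : T K n} (hu : u ∈ avoid (K := K) z) :
      c (single z (u * FreeAlgebra.ι K z * FreeAlgebra.ι K b)) =
        pairing α β γ δ u (FreeAlgebra.ι K b) := by
    have := map_lie_of_mem_avoid hc hdeg ha hu (word K n [a, z, b])
    rw [h, lie_pairing] at this
    simpa [Der.map_mul, single_ι_of_ne ha.symm, single_ι_of_ne hab.symm, mul_assoc] using this
  have h2 := map_lie_of_mem_avoid hc hdeg hb hv (u * FreeAlgebra.ι K z * FreeAlgebra.ι K b)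
  rw [h1 hu, lie_pairing, Der.map_mul, Der.map_mul, single_ι_self, single_ι_of_ne hb.symm,
    mul_zero, add_zero, map_add, map_add, h1 (single_map_mem_avoid b hv hu)] at h2
  exact add_left_cancel h2

/-- The coefficients of `|uv| ⊗ 1` and `1 ⊗ |uv|` vanish: the brackets of the derivations
`u x_z v ∂_z` force `|u' u v v'| = |u u' v' v|` if they do not. -/
theorem exists_map_single_eq (hc : IsOneCocycle c) (hdeg : IsDegreeZero K n c)
    {a b z : Fin n} (hab : a ≠ b) (ha : a ≠ z) (hb : b ≠ z) :
    ∃ γ δ : K, ∀ u ∈ avoid (K := K) z, ∀ v ∈ avoid (K := K) z,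
      c (single z (u * FreeAlgebra.ι K z * v)) =
        γ • proj K n u ⊗ₜ[K] proj K n v + δ • proj K n v ⊗ₜ[K] proj K n u := by
  obtain ⟨α, β, γ, δ, h⟩ := exists_map_eq_pairing hc hdeg ha hb
  have hP {u v : T K n} (hu : u ∈ avoid (K := K) z) (hv : v ∈ avoid (K := K) z) :=
    map_single_eq_pairing hc hdeg hab ha hb h hu hv
  have hcomm {u v u' v' : T K n} (hu : u ∈ avoid (K := K) z) (hv : v ∈ avoid (K := K) z)
      (hu' : u' ∈ avoid (K := K) z) (hv' : v' ∈ avoid (K := K) z) :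
      pairing α β γ δ (u' * u) (v * v') = pairing α β γ δ (u * u') (v' * v) := by
    -- The values `pairing u v` do not involve `x_z`, so both terms of the cocycle identity vanish.
    have h1 := hc (single z (u * FreeAlgebra.ι K z * v)) (single z (u' * FreeAlgebra.ι K z * v'))
    rw [hP hu hv, hP hu' hv', lie_pairing, lie_pairing, lie_single_single] at h1
    simp only [Der.map_mul, single_of_mem_avoid _ hu, single_of_mem_avoid _ hv,
      single_of_mem_avoid _ hu', single_of_mem_avoid _ hv', single_ι_self, zero_mul, mul_zero,
      zero_add, add_zero, pairing_zero_left, pairing_zero_right, sub_self, map_sub, sub_eq_zero]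
      at h1
    rw [← hP ((avoid z).mul_mem hu' hu) ((avoid z).mul_mem hv hv'),
      ← hP ((avoid z).mul_mem hu hu') ((avoid z).mul_mem hv' hv)]
    simpa only [mul_assoc] using h1
  have hA : word K n [a] ∈ avoid (K := K) z := word_mem_avoid (by simp [ha.symm])
  have hB : word K n [b] ∈ avoid (K := K) z := word_mem_avoid (by simp [hb.symm])
  have hAB : word K n [a, b] ∈ avoid (K := K) z := word_mem_avoid (by simp [ha.symm, hb.symm])
  -- The shortest choice for which the two cyclic words differ: `b a a a b` and `a b a b a`.
  have key := hcomm hA hA hB hAB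
  simp only [← word_append, List.cons_append, List.nil_append, pairing,
    ← word_nil (K := K) (n := n)] at key
  have hrot : ¬ [a, b, a, b, a] ~r [b, a, a, a, b] := by
    rw [List.isRotated_iff_mod]
    rintro ⟨k, hk, h⟩
    simp only [List.length_cons, List.length_nil] at hk
    interval_cases k <;> simp [hab, hab.symm] at h
  have hε : cycCoeff (K := K) (n := n) [] (proj K n (word K n [])) = 1 := by
    simpa [-Submodule.mkQ_apply] using cycCoeff_word (K := K) (n := n) [] []
  have hself : [b, a, a, a, b] ~r [b, a, a, a, b] := List.IsRotated.refl _
  have hα : α = 0 := by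
    have := congrArg (cycCoeff₂ [b, a, a, a, b] []) key
    simpa [-Submodule.mkQ_apply, cycCoeff_word, -word_nil, -word_cons, hrot, hself, hε] using this
  have hβ : β = 0 := by
    have := congrArg (cycCoeff₂ [] [b, a, a, a, b]) key
    simpa [-Submodule.mkQ_apply, cycCoeff_word, -word_nil, -word_cons, hrot, hself, hε] using this
  subst hα hβ
  refine ⟨γ, δ, fun u hu v hv => ?_⟩
  rw [hP hu hv]
  simp [pairing]

/-- The two coefficients do not depend on the marked letter. -/
theorem exists_map_single_eq_uniform (hn : 3 ≤ n) (hc : IsOneCocycle c)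
    (hdeg : IsDegreeZero K n c) :
    ∃ γ δ : K, ∀ z, ∀ u ∈ avoid (K := K) z, ∀ v ∈ avoid (K := K) z,
      c (single z (u * FreeAlgebra.ι K z * v)) =
        γ • proj K n u ⊗ₜ[K] proj K n v + δ • proj K n v ⊗ₜ[K] proj K n u := by
  have hthird (i j : Fin n) : ∃ k, k ≠ i ∧ k ≠ j := by
    have : ({i, j} : Finset (Fin n)).card < (Finset.univ : Finset (Fin n)).card := by
      rw [Finset.card_univ, Fintype.card_fin]
      exact Finset.card_le_two.trans_lt hn
    obtain ⟨k, _, hk⟩ := Finset.exists_mem_notMem_of_card_lt_card this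
    exact ⟨k, by simpa using hk⟩
  have hex (z : Fin n) : ∃ γ δ : K, ∀ u ∈ avoid (K := K) z, ∀ v ∈ avoid (K := K) z,
      c (single z (u * FreeAlgebra.ι K z * v)) =
        γ • proj K n u ⊗ₜ[K] proj K n v + δ • proj K n v ⊗ₜ[K] proj K n u := by
    obtain ⟨a, ha, -⟩ := hthird z z
    obtain ⟨b, hb, hba⟩ := hthird z a
    exact exists_map_single_eq hc hdeg hba.symm ha hb
  choose γ δ h using hex
  have heq (i j : Fin n) : γ i = γ j ∧ δ i = δ j := by
    rcases eq_or_ne i j with rfl | hij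
    · exact ⟨rfl, rfl⟩
    obtain ⟨a, hai, haj⟩ := hthird i j
    -- `[x_j ∂_i, x_a x_i ∂_j] = x_a x_j ∂_j - x_a x_i ∂_i`, and the value at `x_a x_i ∂_j` is zero.
    have h1 := map_lie_linear hc hdeg i j (single j (word K n [a, i]))
    rw [map_single_eq_zero hc hdeg (by simp [haj.symm, hij.symm]), lie_zero, lie_single_single,
      map_sub, sub_eq_zero] at h1
    simp only [word_cons, word_nil, mul_one, Der.map_mul, single_ι_self, single_ι_of_ne hai,
      zero_mul, zero_add] at h1
    have h2 := h j _ (word_mem_avoid (w := [a]) (by simp [haj.symm])) 1 (avoid j).one_mem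
    have h3 := h i _ (word_mem_avoid (w := [a]) (by simp [hai.symm])) 1 (avoid i).one_mem
    simp only [word_cons, word_nil, mul_one] at h2 h3
    rw [h2, h3] at h1
    have e : FreeAlgebra.ι K a = word K n [a] := by simp
    rw [e, ← word_nil] at h1
    constructor
    · have := congrArg (cycCoeff₂ [a] []) h1
      simpa [-Submodule.mkQ_apply, cycCoeff_word, -word_nil, -word_cons] using this.symm
    · have := congrArg (cycCoeff₂ [] [a]) h1
      simpa [-Submodule.mkQ_apply, cycCoeff_word, -word_nil, -word_cons] using this.symm
  refine ⟨γ ⟨0, by omega⟩, δ ⟨0, by omega⟩, fun z u hu v hv => ?_⟩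
  rw [h z u hu v hv, (heq z ⟨0, by omega⟩).1, (heq z ⟨0, by omega⟩).2]

end Cocycle

/-! ### The divergence is a cocycle -/

theorem partialD_word (i : Fin n) (w : List (Fin n)) :
    partialD K n i (word K n w) = ∑ j : Fin w.length, if w[j] = i then
      word K n (w.take j) ⊗ₜ[K] word K n (w.drop (j + 1)) else 0 := by
  have := (FreeAlgebra.basisFreeMonoid K (Fin n)).constr_basis K
    (fun w => ∑ j : Fin w.toList.length, if w.toList[j] = i then
      word K n (w.toList.take j) ⊗ₜ[K] word K n (w.toList.drop (j + 1)) else 0) (FreeMonoid.ofList w)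
  rwa [basisFreeMonoid_eq_word] at this

@[simp] theorem partialD_one (i : Fin n) : partialD K n i 1 = 0 := by
  simpa using partialD_word (K := K) i []

theorem partialD_word_cons (i k : Fin n) (w : List (Fin n)) :
    partialD K n i (word K n (k :: w)) = (if k = i then 1 ⊗ₜ[K] word K n w else 0) +
      (FreeAlgebra.ι K k ⊗ₜ[K] 1) * partialD K n i (word K n w) := by
  rw [partialD_word, partialD_word]
  simp only [List.length_cons]
  rw [Fin.sum_univ_succ, Finset.mul_sum]
  congr 1
  refine Finset.sum_congr rfl fun j _ => ?_
  simp [mul_ite]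

/-- The Leibniz rule for the outer bimodule structure of `T ⊗ T`. -/
theorem partialD_mul (i : Fin n) (a b : T K n) :
    partialD K n i (a * b) =
      (a ⊗ₜ[K] 1) * partialD K n i b + partialD K n i a * (1 ⊗ₜ[K] b) := by
  let l : T K n →ₗ[K] T K n ⊗[K] T K n := (TensorProduct.mk K _ _).flip 1
  let r : T K n →ₗ[K] T K n ⊗[K] T K n := TensorProduct.mk K _ _ 1
  have h : (LinearMap.mul K (T K n)).compr₂ (partialD K n i) =
      (LinearMap.mul K (T K n ⊗[K] T K n)).compl₁₂ l (partialD K n i) +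
      (LinearMap.mul K (T K n ⊗[K] T K n)).compl₁₂ (partialD K n i) r := by
    refine linearMap_ext_word fun v => linearMap_ext_word fun w => ?_
    simp only [LinearMap.compr₂_apply, LinearMap.add_apply, LinearMap.compl₁₂_apply,
      LinearMap.mul_apply', LinearMap.flip_apply, TensorProduct.mk_apply, l, r]
    induction v with
    | nil => simp [← Algebra.TensorProduct.one_def]
    | cons k v ih =>
      rw [← word_append, List.cons_append, partialD_word_cons, partialD_word_cons, word_append, ih,
        mul_add, add_mul, ← mul_assoc, ← mul_assoc, Algebra.TensorProduct.tmul_mul_tmul, one_mul,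
        word_cons]
      split_ifs
      · rw [Algebra.TensorProduct.tmul_mul_tmul, one_mul]; abel
      · rw [zero_mul]; abel
  exact LinearMap.congr_fun (LinearMap.congr_fun h a) b

@[simp] theorem partialD_ι (i k : Fin n) :
    partialD K n i (FreeAlgebra.ι K k) = if k = i then 1 else 0 := by
  simpa [Algebra.TensorProduct.one_def] using partialD_word_cons (K := K) i k []

@[simp] theorem partialD_algebraMap (i : Fin n) (r : K) :
    partialD K n i (algebraMap K (T K n) r) = 0 := by
  rw [Algebra.algebraMap_eq_smul_one, map_smul, partialD_one, smul_zero]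

theorem partialD_of_mem_avoid {z : Fin n} {a : T K n} (ha : a ∈ avoid (K := K) z) :
    partialD K n z a = 0 := by
  induction ha using Algebra.adjoin_induction with
  | mem x hx => obtain ⟨i, hi, rfl⟩ := hx; simp [hi]
  | algebraMap r => simp
  | add x y _ _ hx hy => rw [map_add, hx, hy, add_zero]
  | mul x y hx' hy' hx hy => rw [partialD_mul, hx, hy, zero_mul, mul_zero, add_zero]

/-- The insertion product `(p ⊗ q) * (r ⊗ s) = p r ⊗ s q`. -/
def insertion : T K n ⊗[K] T K n →ₗ[K] T K n ⊗[K] T K n →ₗ[K] T K n ⊗[K] T K n :=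
  TensorProduct.lift <| LinearMap.mk₂ K
    (fun p q => TensorProduct.map (LinearMap.mulLeft K p) (LinearMap.mulRight K q))
    (fun p p' q => by ext; simp [add_mul, TensorProduct.add_tmul])
    (fun r p q => by ext; simp [TensorProduct.smul_tmul'])
    (fun p q q' => by ext; simp [mul_add, TensorProduct.tmul_add])
    (fun r p q => by ext; simp)

@[simp] theorem insertion_tmul (p q r s : T K n) :
    insertion (p ⊗ₜ[K] q) (r ⊗ₜ[K] s) = (p * r) ⊗ₜ[K] (s * q) := by
  simp [insertion]

theorem insertion_mul_left (a : T K n) (x y : T K n ⊗[K] T K n) :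
    insertion ((a ⊗ₜ[K] 1) * x) y = (a ⊗ₜ[K] 1) * insertion x y := by
  induction x using TensorProduct.induction_on with
  | zero => simp
  | add x x' hx hx' => simp only [mul_add, map_add, LinearMap.add_apply, hx, hx']
  | tmul p q =>
    induction y using TensorProduct.induction_on with
    | zero => simp
    | add y y' hy hy' => simp only [mul_add, map_add, hy, hy']
    | tmul r s => simp [mul_assoc]

theorem insertion_mul_right (a : T K n) (x y : T K n ⊗[K] T K n) :
    insertion (x * (1 ⊗ₜ[K] a)) y = insertion x y * (1 ⊗ₜ[K] a) := by
  induction x using TensorProduct.induction_on with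
  | zero => simp
  | add x x' hx hx' => simp only [add_mul, map_add, LinearMap.add_apply, hx, hx']
  | tmul p q =>
    induction y using TensorProduct.induction_on with
    | zero => simp
    | add y y' hy hy' => simp only [add_mul, map_add, hy, hy']
    | tmul r s => simp [mul_assoc]

@[simp] theorem insertion_one_left (y : T K n ⊗[K] T K n) : insertion 1 y = y := by
  induction y using TensorProduct.induction_on with
  | zero => simp
  | add y y' hy hy' => rw [map_add, hy, hy']
  | tmul r s => simp [Algebra.TensorProduct.one_def]

/-- The diagonal action of a derivation on `T ⊗ T`. -/
def tensorAct (D : Der K n) : T K n ⊗[K] T K n →ₗ[K] T K n ⊗[K] T K n :=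
  TensorProduct.map D.1 LinearMap.id + TensorProduct.map LinearMap.id D.1

@[simp] theorem tensorAct_tmul (D : Der K n) (a b : T K n) :
    tensorAct D (a ⊗ₜ[K] b) = D.1 a ⊗ₜ[K] b + a ⊗ₜ[K] D.1 b := by
  simp [tensorAct]

theorem tensorAct_mul (D : Der K n) (x y : T K n ⊗[K] T K n) :
    tensorAct D (x * y) = tensorAct D x * y + x * tensorAct D y := by
  induction x using TensorProduct.induction_on with
  | zero => simp
  | add x x' hx hx' => simp only [add_mul, map_add, hx, hx']; abel
  | tmul p q =>
    induction y using TensorProduct.induction_on with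
    | zero => simp
    | add y y' hy hy' => simp only [mul_add, map_add, hy, hy']; abel
    | tmul r s =>
      simp only [Algebra.TensorProduct.tmul_mul_tmul, tensorAct_tmul, Der.map_mul, add_mul, mul_add,
        TensorProduct.add_tmul, TensorProduct.tmul_add]
      abel

/-- The commutation relation between a partial derivative and a derivation: both sides are
derivations of `T` with values in the outer bimodule `T ⊗ T`. -/
theorem partialD_apply (D : Der K n) (i : Fin n) (a : T K n) :
    partialD K n i (D.1 a) = tensorAct D (partialD K n i a) +
      ∑ j, insertion (partialD K n j a) (partialD K n i (D.1 (FreeAlgebra.ι K j))) := by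
  induction a using FreeAlgebra.induction with
  | grade0 r => simp
  | grade1 k =>
    have h : tensorAct D (partialD K n i (FreeAlgebra.ι K k)) = 0 := by
      rw [partialD_ι]
      split_ifs <;> simp [Algebra.TensorProduct.one_def]
    rw [h, zero_add, Finset.sum_eq_single k]
    · simp
    · intro j _ hj
      simp [Ne.symm hj]
    · simp
  | mul a b ha hb =>
    simp only [Der.map_mul, map_add, partialD_mul, ha, hb, tensorAct_mul, tensorAct_tmul,
      Der.map_one, TensorProduct.tmul_zero, TensorProduct.zero_tmul, LinearMap.add_apply,
      insertion_mul_left, insertion_mul_right, Finset.sum_add_distrib, mul_add, add_mul,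
      Finset.mul_sum, Finset.sum_mul, add_zero, zero_add]
    abel
  | add a b ha hb =>
    simp only [map_add, ha, hb, LinearMap.add_apply, Finset.sum_add_distrib]
    abel

theorem divergence_apply (D : Der K n) :
    divergence K n D = ∑ i, TensorProduct.map (proj K n) (proj K n)
      (partialD K n i (D.1 (FreeAlgebra.ι K i))) := by
  simp only [divergence, LinearMap.sum_apply]
  rfl

theorem map_proj_tensorAct (D : Der K n) (x : T K n ⊗[K] T K n) :
    TensorProduct.map (proj K n) (proj K n) (tensorAct D x) =
      ⁅D, TensorProduct.map (proj K n) (proj K n) x⁆ := by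
  induction x using TensorProduct.induction_on with
  | zero => simp
  | add x x' hx hx' => rw [map_add, map_add, map_add, hx, hx', lie_add]
  | tmul p q =>
    rw [tensorAct_tmul, map_add, TensorProduct.map_tmul, TensorProduct.map_tmul,
      TensorProduct.map_tmul, TensorProduct.LieModule.lie_tmul_right, lie_proj, lie_proj]

theorem map_proj_insertion_comm (x y : T K n ⊗[K] T K n) :
    TensorProduct.map (proj K n) (proj K n) (insertion x y) =
      TensorProduct.map (proj K n) (proj K n) (insertion y x) := by
  induction x using TensorProduct.induction_on with
  | zero => simp
  | add x x' hx hx' => simp only [map_add, LinearMap.add_apply, hx, hx']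
  | tmul p q =>
    induction y using TensorProduct.induction_on with
    | zero => simp
    | add y y' hy hy' => simp only [map_add, LinearMap.add_apply, hy, hy']
    | tmul r s =>
      rw [insertion_tmul, insertion_tmul, TensorProduct.map_tmul, TensorProduct.map_tmul,
        proj_mul_comm p r, proj_mul_comm s q]

theorem isOneCocycle_divergence : IsOneCocycle (divergence K n) := by
  have h (D E : Der K n) : ∑ i, TensorProduct.map (proj K n) (proj K n)
      (partialD K n i (D.1 (E.1 (FreeAlgebra.ι K i)))) = ⁅D, divergence K n E⁆ +
      ∑ i, ∑ j, TensorProduct.map (proj K n) (proj K n)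
        (insertion (partialD K n j (E.1 (FreeAlgebra.ι K i)))
          (partialD K n i (D.1 (FreeAlgebra.ι K j)))) := by
    rw [divergence_apply, lie_sum, ← Finset.sum_add_distrib]
    refine Finset.sum_congr rfl fun i _ => ?_
    rw [partialD_apply, map_add, map_proj_tensorAct, map_sum]
  intro D E
  have h' : divergence K n ⁅D, E⁆ =
      ∑ i, TensorProduct.map (proj K n) (proj K n)
        (partialD K n i (D.1 (E.1 (FreeAlgebra.ι K i)))) -
      ∑ i, TensorProduct.map (proj K n) (proj K n)
        (partialD K n i (E.1 (D.1 (FreeAlgebra.ι K i)))) := by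
    rw [divergence_apply, ← Finset.sum_sub_distrib]
    simp only [Der.lie_apply, map_sub]
  rw [h', h, h]
  have hs := Finset.sum_comm (s := Finset.univ) (t := Finset.univ)
    (f := fun i j => TensorProduct.map (proj K n) (proj K n)
        (insertion (partialD K n j (E.1 (FreeAlgebra.ι K i)))
          (partialD K n i (D.1 (FreeAlgebra.ι K j)))))
  simp only [map_proj_insertion_comm (partialD K n _ (E.1 _))] at hs ⊢
  rw [hs]
  abel

theorem lie_switch (D : Der K n) (x : Cyc K n ⊗[K] Cyc K n) :
    switch K n ⁅D, x⁆ = ⁅D, switch K n x⁆ := by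
  induction x using TensorProduct.induction_on with
  | zero => simp
  | add x y hx hy => rw [lie_add, map_add, map_add, hx, hy, lie_add]
  | tmul p q => simp [switch, TensorProduct.LieModule.lie_tmul_right, add_comm]

/-- The divergence of a derivation `u x_z v ∂_z` with exactly one letter `x_z`. -/
theorem divergence_single {z : Fin n} {u v : T K n} (hu : u ∈ avoid (K := K) z)
    (hv : v ∈ avoid (K := K) z) :
    divergence K n (single z (u * FreeAlgebra.ι K z * v)) = proj K n u ⊗ₜ[K] proj K n v := by
  rw [divergence_apply, Finset.sum_eq_single z]
  · rw [single_ι_self, partialD_mul, partialD_mul, partialD_of_mem_avoid hu,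
      partialD_of_mem_avoid hv]
    simp
  · intro j _ hj
    rw [single_ι_of_ne hj]
    simp
  · simp

theorem divergence_single_of_mem_avoid {z : Fin n} {u : T K n} (hu : u ∈ avoid (K := K) z) :
    divergence K n (single z u) = 0 := by
  rw [divergence_apply]
  refine Finset.sum_eq_zero fun j _ => ?_
  rw [single_ι]
  split_ifs with h
  · rw [h, partialD_of_mem_avoid hu, map_zero]
  · rw [map_zero, map_zero]

/-! ### Generation by derivations with at most one marked letter -/

/-- The derivation `w ∂_z` attached to a letter and a word. -/
abbrev mono (z : Fin n) (w : List (Fin n)) : Der K n := single z (word K n w)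

section Generation

variable {N : Submodule K (Der K n)}

/-- Words `z a v z w` with a doubled marked letter in first position, by eliminating
`a z v z w ∂_z` from its two expressions through brackets. The intermediate congruence
`a z v z w ∂_z ≡ a a v z w ∂_a` is recorded as well. -/
theorem mono_cons_cons_mem (hN : ∀ u ∈ N, ∀ v ∈ N, ⁅u, v⁆ ∈ N)
    (h1 : ∀ z w, w.count z ≤ 1 → mono z w ∈ N) {z a : Fin n} (haz : a ≠ z)
    {v w : List (Fin n)} (hav : a ∉ v) (haw : a ∉ w) (hzv : z ∉ v) (hzw : z ∉ w) :
    mono z (a :: z :: v ++ z :: w) - mono a (a :: a :: v ++ z :: w) ∈ N ∧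
      mono z (z :: a :: v ++ z :: w) ∈ N := by
  have e1 : mono (K := K) z (a :: z :: v ++ z :: w) - mono a (a :: a :: v ++ z :: w) =
      ⁅mono (K := K) a [a, z], mono z (a :: v ++ z :: w)⁆ := by
    simp [mono, lie_single_single, Der.map_mul, single_word_of_notMem, single_ι_of_ne, *,
      mul_assoc, haz.symm]
  have e2 : mono (K := K) z (z :: a :: v ++ z :: w) =
      ⁅mono (K := K) a [z], mono z (a :: a :: v ++ z :: w)⁆ -
        (mono z (a :: z :: v ++ z :: w) - mono a (a :: a :: v ++ z :: w)) := by
    simp [mono, lie_single_single, Der.map_mul, single_word_of_notMem, single_ι_of_ne, *,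
      haz.symm]
  have m1 : mono z (a :: z :: v ++ z :: w) - mono a (a :: a :: v ++ z :: w) ∈ N := by
    rw [e1]
    exact hN _ (h1 _ _ (by simp [haz.symm])) _ (h1 _ _ (by simp [List.count_eq_zero.2, *]))
  refine ⟨m1, ?_⟩
  rw [e2]
  exact N.sub_mem (hN _ (h1 _ _ (by simp [haz.symm])) _
    (h1 _ _ (by simp [List.count_eq_zero.2, *]))) m1

/-- Words `b z a z w`: up to a bracket, `b z a z w ∂_z` is `a b z a w ∂_a`, whose doubled letter is
in first position. -/
theorem mono_alternating_mem (hN : ∀ u ∈ N, ∀ v ∈ N, ⁅u, v⁆ ∈ N)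
    (h1 : ∀ z w, w.count z ≤ 1 → mono z w ∈ N) {z a b : Fin n} (haz : a ≠ z) (hbz : b ≠ z)
    (hab : a ≠ b) {w : List (Fin n)} (haw : a ∉ w) (hbw : b ∉ w) (hzw : z ∉ w) :
    mono z (b :: z :: a :: z :: w) ∈ N := by
  have e : mono (K := K) z (b :: z :: a :: z :: w) =
      ⁅mono (K := K) a [a, z], mono z (b :: z :: a :: w)⁆ + mono a (a :: b :: [z] ++ a :: w) := by
    simp [mono, lie_single_single, Der.map_mul, single_word_of_notMem, single_ι_of_ne, *,
      mul_assoc, haz.symm, hab.symm]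
  rw [e]
  refine N.add_mem (hN _ (h1 _ _ (by simp [haz.symm])) _
    (h1 _ _ (by simp [List.count_eq_zero.2, *]))) ?_
  exact (mono_cons_cons_mem hN h1 hab.symm (by simp [hbz]) hbw (by simp [haz]) haw).2

/-- Words `z z a b w`: the congruence of `mono_cons_cons_mem`, with `b` as the marked letter,
identifies `z z a b w ∂_z` with the alternating `z b a b w ∂_b`. -/
theorem mono_double_mem (hN : ∀ u ∈ N, ∀ v ∈ N, ⁅u, v⁆ ∈ N)
    (h1 : ∀ z w, w.count z ≤ 1 → mono z w ∈ N) {z a b : Fin n} (haz : a ≠ z) (hbz : b ≠ z)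
    (hab : a ≠ b) {w : List (Fin n)} (haw : a ∉ w) (hbw : b ∉ w) (hzw : z ∉ w) :
    mono z (z :: z :: a :: b :: w) ∈ N := by
  have h := (mono_cons_cons_mem hN h1 (z := b) (a := z) (v := [a]) (w := w) hbz.symm
    (by simp [haz.symm]) hzw (by simp [hab.symm]) hbw).1
  have h' := mono_alternating_mem hN h1 (z := b) (a := a) (b := z) hab hbz.symm haz haw hzw hbw
  have := N.sub_mem h' h
  simpa using this

theorem mono_cons_append_mem (hN : ∀ u ∈ N, ∀ v ∈ N, ⁅u, v⁆ ∈ N)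
    (h1 : ∀ z w, w.count z ≤ 1 → mono z w ∈ N) {z : Fin n} {v w : List (Fin n)}
    (hnd : (z :: v ++ w).Nodup) (hlen : 2 ≤ (v ++ w).length) :
    mono z (z :: v ++ z :: w) ∈ N := by
  match v, w with
  | a :: v, w =>
    simp only [List.cons_append, List.nodup_cons, List.mem_cons, List.mem_append, not_or] at hnd
    obtain ⟨⟨hza, hzv, hzw⟩, ⟨hav, haw⟩, -⟩ := hnd
    exact (mono_cons_cons_mem hN h1 (Ne.symm hza) hav haw hzv hzw).2
  | [], a :: b :: w =>
    simp only [List.cons_append, List.nil_append, List.nodup_cons, List.mem_cons, not_or] at hnd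
    obtain ⟨⟨hza, hzb, hzw⟩, ⟨hab, haw⟩, hbw, -⟩ := hnd
    exact mono_double_mem hN h1 (Ne.symm hza) (Ne.symm hzb) hab haw hbw hzw
  | [], [a] => simp at hlen
  | [], [] => simp at hlen

/-- If `z` occurs twice and the other letters at most once, acting with the linear vector field
`x_z ∂_a`, for `a` the first letter, moves a doubled letter to the first position. -/
theorem mono_multilinear_mem (hN : ∀ u ∈ N, ∀ v ∈ N, ⁅u, v⁆ ∈ N)
    (h1 : ∀ z w, w.count z ≤ 1 → mono z w ∈ N) {z : Fin n} {u v w : List (Fin n)}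
    (hnd : (z :: u ++ v ++ w).Nodup) (hlen : 2 ≤ (u ++ v ++ w).length) :
    mono z (u ++ z :: v ++ z :: w) ∈ N := by
  match u with
  | [] => exact mono_cons_append_mem hN h1 (by simpa using hnd) (by simpa using hlen)
  | a :: u =>
    have hnd' := hnd
    simp only [List.cons_append, List.nodup_cons, List.mem_cons, List.mem_append, not_or] at hnd'
    obtain ⟨⟨hza, ⟨hzu, hzv⟩, hzw⟩, ⟨⟨hau, hav⟩, haw⟩, hnd''⟩ := hnd'
    have e : mono (K := K) z (a :: u ++ z :: v ++ z :: w) =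
        ⁅mono (K := K) a [z], mono z (a :: u ++ a :: v ++ z :: w)⁆ -
          mono z (z :: (u ++ a :: v) ++ z :: w) + mono a (a :: u ++ a :: (v ++ z :: w)) := by
      simp [mono, lie_single_single, Der.map_mul, single_word_of_notMem, single_ι_of_ne, *]
      abel
    rw [e]
    refine N.add_mem (N.sub_mem (hN _ (h1 _ _ ?_) _ (h1 _ _ ?_)) ?_) ?_
    · simp [hza]
    · simp [Ne.symm hza, List.count_eq_zero.2, *]
    · refine mono_cons_append_mem hN h1 ?_ ?_
      · have h := (List.perm_middle (a := a) (l₁ := z :: u) (l₂ := v ++ w)).nodup_iff.2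
        simp only [List.cons_append, List.append_assoc] at h hnd ⊢
        exact h ((List.Perm.swap _ _ _).nodup_iff.2 hnd)
      · simp at hlen ⊢; omega
    · refine mono_cons_append_mem hN h1 ?_ ?_
      · have h := (List.perm_middle (a := z) (l₁ := a :: u ++ v) (l₂ := w)).nodup_iff.2
        simp only [List.cons_append, List.append_assoc] at h hnd ⊢
        exact h hnd
      · simp at hlen ⊢; omega

/-- A space of derivations that is closed under the bracket and contains all `w ∂_z` with at most
one letter `x_z` in `w` contains all `w ∂_z` of degree at most `n`. The bound on the degree ensures
that a word without missing letter has at most one repetition. -/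
theorem mono_mem (hn : 3 ≤ n) (hN : ∀ u ∈ N, ∀ v ∈ N, ⁅u, v⁆ ∈ N)
    (h1 : ∀ z w, w.count z ≤ 1 → mono z w ∈ N) (z : Fin n) (w : List (Fin n))
    (hw : w.length ≤ n + 1) : mono z w ∈ N := by
  induction hr : w.count z using Nat.strong_induction_on generalizing w with
  | _ r ih =>
  subst hr
  rcases Nat.lt_or_ge (w.count z) 2 with hr | hr
  · exact h1 z w (by omega)
  obtain ⟨u, w', rfl⟩ := List.append_of_mem (List.count_pos_iff.1 (by omega : 0 < w.count z))
  by_cases hall : ∃ a, a ∉ u ++ z :: w'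
  -- A missing letter `a` may replace one occurrence of `z`, which lowers the multiplicity of `z`.
  · obtain ⟨a, ha⟩ := hall
    simp only [List.mem_append, List.mem_cons, not_or] at ha
    obtain ⟨hau, haz, haw⟩ := ha
    have e : mono (K := K) z (u ++ z :: w') =
        ⁅mono (K := K) a [z], mono z (u ++ a :: w')⁆ + mono a (u ++ a :: w') := by
      simp [mono, lie_single_single, Der.map_mul, single_word_of_notMem, *]
    rw [e]
    refine N.add_mem (hN _ (h1 _ _ ?_) _ (ih _ ?_ _ ?_ rfl)) (h1 _ _ ?_)
    · simp [Ne.symm haz]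
    · simp [haz]
    · simpa using hw
    · simp [List.count_eq_zero.2, *]
  -- No letter is missing: `z` then occurs exactly twice, the other letters exactly once.
  · push Not at hall
    have hz : z ∈ u ++ w' := List.count_pos_iff.1 (by
      simp only [List.count_append, List.count_cons_self] at hr ⊢; omega)
    obtain ⟨p, v, q, hpvq⟩ : ∃ p v q, u ++ z :: w' = p ++ z :: v ++ z :: q := by
      rcases List.mem_append.1 hz with h | h
      · obtain ⟨s, t, rfl⟩ := List.append_of_mem h
        exact ⟨s, t, w', by simp⟩
      · obtain ⟨s, t, rfl⟩ := List.append_of_mem h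
        exact ⟨u, s, t, by simp⟩
    rw [hpvq] at hall hw ⊢
    -- All `n` letters occur in `z p v q`, a word of length at most `n`.
    have huniv : (z :: p ++ v ++ q).toFinset = Finset.univ := by
      ext a
      have := hall a
      simp only [List.mem_append, List.mem_cons] at this
      simp only [List.mem_toFinset, List.mem_append, List.mem_cons, Finset.mem_univ, iff_true]
      tauto
    have hcard : (z :: p ++ v ++ q).toFinset.card = n := by
      rw [huniv, Finset.card_univ, Fintype.card_fin]
    have hle := List.toFinset_card_le (z :: p ++ v ++ q)
    have hlen : (z :: p ++ v ++ q).length ≤ n := by simp at hw ⊢; omega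
    refine mono_multilinear_mem hN h1 ?_ ?_
    · exact Multiset.coe_nodup.1 (Multiset.toFinset_card_eq_card_iff_nodup.1
        (le_antisymm hle (hlen.trans hcard.ge)))
    · simp at hle hcard hlen ⊢; omega

end Generation

/-! ### Comparison of a cocycle with the divergence -/

theorem Der.map_ι_mem_algDeg {d : ℤ} {D : Der K n} (hD : D ∈ derDeg K n d) (i : Fin n) :
    D.1 (FreeAlgebra.ι K i) ∈ algDeg K n (1 + d) :=
  hD 1 _ (Submodule.subset_span ⟨[i], by simp, by simp⟩)

/-- The cocycle obtained by subtracting multiples of the divergence and of its transpose. -/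
theorem IsOneCocycle.sub_divergence {c : Der K n →ₗ[K] Cyc K n ⊗[K] Cyc K n}
    (hc : IsOneCocycle c) (γ δ : K) :
    IsOneCocycle (c - (γ • divergence K n + δ • (switch K n ∘ₗ divergence K n))) := by
  have hs (D : Der K n) (r : K) (x : Cyc K n ⊗[K] Cyc K n) : ⁅D, r • x⁆ = r • ⁅D, x⁆ :=
    lie_smul r D x
  intro u v
  simp only [LinearMap.sub_apply, LinearMap.add_apply, LinearMap.smul_apply, LinearMap.comp_apply,
    hc u v, isOneCocycle_divergence u v, map_sub, lie_switch, lie_sub, lie_add, hs, smul_sub]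
  abel

end FreeDer

end

theorem theorem1p1 {K : Type*} [Field K] [CharZero K] (n : ℕ) (hn : 3 ≤ n)
    (c : FreeDer.Der K n →ₗ[K] FreeDer.Cyc K n ⊗[K] FreeDer.Cyc K n)
    (hc : FreeDer.IsOneCocycle c) (hdeg : FreeDer.IsDegreeZero K n c)
    (k : ℕ) (hk : k ≤ n) :
    ∃ a b : K, ∀ D ∈ FreeDer.derRange K n k,
      c D = a • FreeDer.divergence K n D + b • FreeDer.switch K n (FreeDer.divergence K n D) := by
  obtain ⟨γ, δ, h⟩ := FreeDer.exists_map_single_eq_uniform hn hc hdeg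
  refine ⟨γ, δ, ?_⟩
  set g := c - (γ • FreeDer.divergence K n + δ • (FreeDer.switch K n ∘ₗ FreeDer.divergence K n))
    with hg
  have hgc : FreeDer.IsOneCocycle g := hc.sub_divergence γ δ
  have hN : ∀ u ∈ LinearMap.ker g, ∀ v ∈ LinearMap.ker g, ⁅u, v⁆ ∈ LinearMap.ker g := by
    intro u hu v hv
    rw [LinearMap.mem_ker] at hu hv ⊢
    rw [hgc, hu, hv, lie_zero, lie_zero, sub_zero]
  have h1 : ∀ z w, w.count z ≤ 1 → FreeDer.mono z w ∈ LinearMap.ker g := by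
    intro z w hw
    rw [LinearMap.mem_ker, hg, LinearMap.sub_apply, sub_eq_zero]
    by_cases hz : z ∈ w
    · obtain ⟨u, v, rfl⟩ := List.append_of_mem hz
      simp only [List.count_append, List.count_cons_self] at hw
      have hu := FreeDer.word_mem_avoid (K := K) (List.count_eq_zero.1 (by omega : u.count z = 0))
      have hv := FreeDer.word_mem_avoid (K := K) (List.count_eq_zero.1 (by omega : v.count z = 0))
      rw [FreeDer.mono, FreeDer.word_append, FreeDer.word_cons, ← mul_assoc, h z _ hu _ hv]
      simp only [LinearMap.add_apply, LinearMap.smul_apply, LinearMap.comp_apply,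
        FreeDer.divergence_single hu hv]
      rfl
    · rw [FreeDer.map_single_eq_zero hc hdeg hz]
      simp [FreeDer.divergence_single_of_mem_avoid (FreeDer.word_mem_avoid hz)]
  -- `D` is the sum of the `D(x_i) ∂_i`, where `D(x_i)` has degree `d + 1 ≤ n + 1`.
  suffices hle : FreeDer.derRange K n k ≤ LinearMap.ker g by
    intro D hD
    exact sub_eq_zero.1 (LinearMap.mem_ker.1 (hle hD))
  refine iSup₂_le fun d hd D hD => ?_
  rw [FreeDer.Der.eq_sum_single D]
  refine Submodule.sum_mem _ fun i _ => ?_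
  have hi := FreeDer.Der.map_ι_mem_algDeg hD i
  refine Submodule.span_induction ?_ (by rw [map_zero]; exact Submodule.zero_mem _)
    (fun x y _ _ hx hy => by rw [map_add]; exact Submodule.add_mem _ hx hy)
    (fun r x _ hx => by rw [map_smul]; exact Submodule.smul_mem _ r hx) hi
  rintro _ ⟨w, hw, rfl⟩
  refine FreeDer.mono_mem hn hN h1 i w ?_
  have := hd.2
  omega
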